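/- Let $D\subset\mathbb C$ be a simply connected domain with coordinate $z=x+iy$, and let $\sigma_0=I$, $\sigma_1=\begin{pmatrix}0&1\\1&0\end{pmatrix}$, $\sigma_2=\begin{pmatrix}0&i\\-i&0\end{pmatrix}$, $\sigma_3=\begin{pmatrix}1&0\\0&-1\end{pmatrix}$. Let $\Lambda\mathrm{SU}(2)$ be the set of maps $g:S^1\to \mathrm{SU}(2)$ with $g(-\theta)=\sigma_3\,g(\theta)\,\sigma_3^{-1}$, and identify $\mathbb R^3$ with $\mathrm{span}_{\mathbb R}(\sigma_1,\sigma_2,\sigma_3)$ and Minkowski space $\mathbb R^{3,1}$ with the Hermitian $2\times2$ matrices by $x\mapsto\sum_{k=0}^3x^k\sigma_k$, so that $\mathbb H^3=\{x:\langle x,x\rangle=-1,\ x^0>0\}$ has curvature $-1$. Let $\widetilde N:D\to S^2$ be a smooth harmonic map which is non-conformal, i.e. $\langle\widetilde N_z,\widetilde N_z\rangle$ does not vanish identically on $D$, and let $\widetilde F=\widetilde F(\theta):D\to\Lambda\mathrm{SU}(2)$ be a lift (extended frame) of $\widetilde N$: $\widetilde F(\theta)$ is smooth on $D$ for each $\theta\in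 S^1$, $\widetilde N=\widetilde F(1)\,\sigma_3\,\widetilde F(1)^{-1}$, and, where $\Omega_0$ denotes the diagonal part of $\widetilde F(1)^{-1}d\widetilde F(1)$ and $\Omega'$, $\Omega''$ the $(1,0)$- and $(0,1)$-parts of its off-diagonal part, $$\widetilde\Omega(\theta):=\widetilde F(\theta)^{-1}d\widetilde F(\theta)=\widetilde\Omega_1'+\widetilde\Omega_0+\widetilde\Omega_1'',\qquad \widetilde\Omega_1'=\theta^{-1}\Omega',\quad \widetilde\Omega_0=\Omega_0,\quad \widetilde\Omega_1''=\theta\,\Omega'' \qquad(\theta\in S^1).$$ For a real constant $a>0$ put $$\beta_1'(a)=\tfrac14(a-1)(\sigma_0-\sigma_3)\,\widetilde\Omega_1'\,(\sigma_0+\sigma_3),\qquad \beta_1''(a)=\tfrac14(a^{-1}-1)(\sigma_0+\sigma_3)\,\widetilde\Omega_1''\,(\sigma_0-\sigma_3),$$ $$\Omega=\Omega(a,\theta)=\widetilde\Omega(\theta)+\beta_1'(a)+\beta_1''(a).$$ Then for every $\theta\in S^1$: (i) $\Omega(a,\theta)$ is smooth and $d\Omega(a,\theta)+\tfrac12[\Omega(a,\theta)\wedge\Omega(a,\theta)]=0$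 on $D$. (ii) If $a\neq1$ and $F:D\to\mathrm{SL}(2,\mathbb C)$ is a solution of $F^{-1}dF=\Omega(a,\theta)$, then $f=FF^*$ is a smooth map $D\to\mathbb H^3$; the points at which $f$ is not an immersion are isolated (they do not accumulate in $D$); and away from them $f$ is a conformal immersion of constant mean curvature $$H=\frac{a^2+1}{a^2-1}$$ with respect to the unit normal field $N$ for which $(f,f_x,f_y,N)$ is a positively oriented basis of $\mathbb R^{3,1}$. -/

import Mathlib

open scoped Matrix ContDiff

noncomputable section

namespace HypCMC

/-- Complex `2 × 2` matrices. Matrix-valued functions are differentiated entry by entry. -/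
abbrev Mat : Type := Matrix (Fin 2) (Fin 2) ℂ

/-! ### Pauli matrices and Minkowski space -/

def σ₀ : Mat := !![1, 0; 0, 1]

def σ₁ : Mat := !![0, 1; 1, 0]

def σ₂ : Mat := !![0, Complex.I; -Complex.I, 0]

def σ₃ : Mat := !![1, 0; 0, -1]

/-- The space `ℝ^{3,1}` with coordinates `(x⁰, x¹, x², x³)`. -/
abbrev R31 : Type := Fin 4 → ℝ

/-- The Lorentz product of signature `(-, +, +, +)`. -/
def lorentz (x y : R31) : ℝ := -(x 0 * y 0) + x 1 * y 1 + x 2 * y 2 + x 3 * y 3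

/-- Hyperbolic 3-space of curvature `-1`, as a sheet of the hyperboloid. -/
def H3 : Set R31 := {x | lorentz x x = -1 ∧ 0 < x 0}

/-- The identification of `ℝ^{3,1}` with the Hermitian `2 × 2` matrices. -/
def toHerm (x : R31) : Mat :=
  (x 0 : ℂ) • σ₀ + (x 1 : ℂ) • σ₁ + (x 2 : ℂ) • σ₂ + (x 3 : ℂ) • σ₃

/-- The inverse identification (meaningful on Hermitian matrices). -/
def ofHerm (X : Mat) : R31 :=
  ![(X 0 0 + X 1 1).re / 2, (X 0 1 + X 1 0).re / 2, (X 0 1 - X 1 0).im / 2,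
    (X 0 0 - X 1 1).re / 2]

theorem toHerm_eq (x : R31) :
    toHerm x = !![(x 0 : ℂ) + x 3, x 1 + Complex.I * x 2; x 1 - Complex.I * x 2, x 0 - x 3] := by
  ext i j
  fin_cases i <;> fin_cases j <;> simp [toHerm, σ₀, σ₁, σ₂, σ₃] <;> ring

theorem ofHerm_toHerm (x : R31) : ofHerm (toHerm x) = x := by
  rw [toHerm_eq]
  ext i
  fin_cases i <;> simp [ofHerm]

theorem toHerm_ofHerm {X : Mat} (hX : X.IsHermitian) : toHerm (ofHerm X) = X := by
  have h00 := hX.apply 0 0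
  have h11 := hX.apply 1 1
  have h01 := hX.apply 0 1
  rw [toHerm_eq]
  simp only [Complex.ext_iff, Complex.star_def, Complex.conj_re, Complex.conj_im] at h00 h11 h01
  ext i j
  apply Complex.ext <;> fin_cases i <;> fin_cases j <;> simp [ofHerm] <;> linarith

/-! ### Matrix-valued functions and 1-forms on plane domains -/

/-- Smoothness on `D` of a matrix-valued function. -/
def SmoothMatOn (D : Set ℂ) (F : ℂ → Mat) : Prop :=
  ∀ i j, ContDiffOn ℝ ∞ (fun z => F z i j) D

/-- Matrix-valued (real) 1-forms: to each point a real-linear map from the tangent space `ℂ`. -/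
abbrev MForm : Type := ℂ → ℂ →ₗ[ℝ] Mat

/-- The differential `dF` of a matrix-valued function. -/
def dMat (F : ℂ → Mat) : MForm := fun z =>
  { toFun := fun v => Matrix.of fun i j => fderiv ℝ (fun w => F w i j) z v
    map_add' := fun v w => by ext i j; simp
    map_smul' := fun c v => by
      ext i j
      simp only [Matrix.of_apply, map_smul, Matrix.smul_apply, RingHom.id_apply] }

/-- The exterior derivative of a matrix-valued 1-form, evaluated on a pair of vectors:
`dΩ(v, w) = ∂_v Ω(w) - ∂_w Ω(v)`. -/
def extD (Ω : MForm) (z v w : ℂ) : Mat := dMat (fun y => Ω y w) z v - dMat (fun y => Ω y v) z w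

/-- `[Ω₁ ∧ Ω₂]` evaluated on a pair of vectors, that is `[Ω₁(v), Ω₂(w)] - [Ω₁(w), Ω₂(v)]`. -/
def wedgeBracket (Ω₁ Ω₂ : MForm) (z v w : ℂ) : Mat := ⁅Ω₁ z v, Ω₂ z w⁆ - ⁅Ω₁ z w, Ω₂ z v⁆

/-- The Maurer-Cartan equation `dΩ + ½ [Ω ∧ Ω] = 0` on `D`, for a smooth 1-form `Ω`. -/
structure SatisfiesMaurerCartan (D : Set ℂ) (Ω : MForm) : Prop where
  smooth : ∀ v, SmoothMatOn D (fun z => Ω z v)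
  flat : ∀ z ∈ D, ∀ v w : ℂ, extD Ω z v w + (1 / 2 : ℂ) • wedgeBracket Ω Ω z v w = 0

/-- The `(1,0)`-part of a 1-form at a point: the `A dz` in `A dz + B dz̄`. -/
def part10 (η : ℂ →ₗ[ℝ] Mat) : ℂ →ₗ[ℝ] Mat :=
  (1 / 2 : ℂ) • (η - Complex.I • η.comp (LinearMap.mulLeft ℝ Complex.I))

/-- The `(0,1)`-part of a 1-form at a point: the `B dz̄` in `A dz + B dz̄`. -/
def part01 (η : ℂ →ₗ[ℝ] Mat) : ℂ →ₗ[ℝ] Mat :=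
  (1 / 2 : ℂ) • (η + Complex.I • η.comp (LinearMap.mulLeft ℝ Complex.I))

/-- The 1-form `P η Q`. -/
def sandwich (P Q : Mat) (η : ℂ →ₗ[ℝ] Mat) : ℂ →ₗ[ℝ] Mat :=
  (LinearMap.mulLeft ℝ P).comp ((LinearMap.mulRight ℝ Q).comp η)

/-- The diagonal part of a 1-form. -/
def diagPart (η : ℂ →ₗ[ℝ] Mat) : ℂ →ₗ[ℝ] Mat := (1 / 2 : ℂ) • (η + sandwich σ₃ σ₃ η)

/-- The off-diagonal part of a 1-form. -/
def offDiagPart (η : ℂ →ₗ[ℝ] Mat) : ℂ →ₗ[ℝ] Mat := (1 / 2 : ℂ) • (η - sandwich σ₃ σ₃ η)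

/-- The form `F⁻¹ dF`. -/
def mcForm (F : ℂ → Mat) : MForm := fun z => (LinearMap.mulLeft ℝ (F z)⁻¹).comp (dMat F z)

/-- `F` is an `SL(2, ℂ)`-valued solution on `D` of `Ω = F⁻¹ dF`. -/
structure IsSLSolution (D : Set ℂ) (Ω : MForm) (F : ℂ → Mat) : Prop where
  differentiableAt : ∀ z ∈ D, ∀ i j, DifferentiableAt ℝ (fun w => F w i j) z
  det_eq_one : ∀ z ∈ D, (F z).det = 1
  mcForm_eq : ∀ z ∈ D, mcForm F z = Ω z

/-! ### Harmonic maps into the 2-sphere and their lifts -/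

/-- A smooth map from the plane domain `D` into the unit sphere of `ℝ³` that is harmonic as a map
into the sphere. -/
structure IsHarmonicSphereMap (D : Set ℂ) (N : ℂ → EuclideanSpace ℝ (Fin 3)) : Prop where
  smooth : ContDiffOn ℝ ∞ N D
  norm_eq_one : ∀ z ∈ D, ‖N z‖ = 1
  harmonic : ∀ z ∈ D, Laplacian.laplacian N z =
    -(‖fderiv ℝ N z 1‖ ^ 2 + ‖fderiv ℝ N z Complex.I‖ ^ 2) • N z

/-- Conformality of a map in the sense of harmonic map theory (critical points are allowed):
`⟨N_z, N_z⟩ = 0` on `D`. -/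
def IsConformalMapOn (D : Set ℂ) (N : ℂ → EuclideanSpace ℝ (Fin 3)) : Prop :=
  ∀ z ∈ D, ‖fderiv ℝ N z 1‖ = ‖fderiv ℝ N z Complex.I‖ ∧
    inner ℝ (fderiv ℝ N z 1) (fderiv ℝ N z Complex.I) = 0

/-- The twisted loop group `ΛSU(2)`. -/
def LoopSU2 : Set (Circle → Mat) :=
  {g | (∀ θ, g θ ∈ Matrix.specialUnitaryGroup (Fin 2) ℂ) ∧ ∀ θ, g (-θ) = σ₃ * g θ * σ₃⁻¹}

/-- `Ft = Ft(z, θ)` is a lift (extended frame) `D → ΛSU(2)` of `N : D → S²`: at `θ = 1` it projects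
to `N` under `SU(2) → SU(2)/U(1) = S²`, `F ↦ F σ₃ F⁻¹`, and the Maurer-Cartan form depends on
the loop parameter by `Ω(θ) = θ⁻¹ Ω₁' + Ω₀ + θ Ω₁''`, where `Ω₀` is the diagonal part and `Ω₁'`,
`Ω₁''` are the `(1,0)`- and `(0,1)`-parts of the off-diagonal part of `Ω(1)`. -/
structure IsExtendedLift (D : Set ℂ) (N : ℂ → EuclideanSpace ℝ (Fin 3))
    (Ft : ℂ → Circle → Mat) : Prop where
  mem_loop : ∀ z ∈ D, Ft z ∈ LoopSU2
  smooth : ∀ θ, SmoothMatOn D (fun z => Ft z θ)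
  projects : ∀ z ∈ D,
    Ft z 1 * σ₃ * (Ft z 1)⁻¹ = (N z 0 : ℂ) • σ₁ + (N z 1 : ℂ) • σ₂ + (N z 2 : ℂ) • σ₃
  mcForm_eq : ∀ θ : Circle, ∀ z ∈ D, mcForm (fun w => Ft w θ) z =
    (θ : ℂ)⁻¹ • part10 (offDiagPart (mcForm (fun w => Ft w 1) z))
      + diagPart (mcForm (fun w => Ft w 1) z)
      + (θ : ℂ) • part01 (offDiagPart (mcForm (fun w => Ft w 1) z))

/-- The Maurer-Cartan form `Ω̃(θ)` of a lift. -/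
def liftForm (Ft : ℂ → Circle → Mat) (θ : Circle) : MForm := mcForm (fun z => Ft z θ)

/-- `β₁'(a) = ¼ (a - 1) (σ₀ - σ₃) Ω̃₁' (σ₀ + σ₃)`, with `Ω̃₁'` the off-diagonal `(1,0)`-part. -/
def beta10 (Ft : ℂ → Circle → Mat) (a : ℝ) (θ : Circle) : MForm := fun z =>
  ((1 / 4 : ℂ) * ((a : ℂ) - 1)) •
    sandwich (σ₀ - σ₃) (σ₀ + σ₃) (part10 (offDiagPart (liftForm Ft θ z)))

/-- `β₁''(a) = ¼ (a⁻¹ - 1) (σ₀ + σ₃) Ω̃₁'' (σ₀ - σ₃)`, with `Ω̃₁''` the off-diagonal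
`(0,1)`-part. -/
def beta01 (Ft : ℂ → Circle → Mat) (a : ℝ) (θ : Circle) : MForm := fun z =>
  ((1 / 4 : ℂ) * ((a : ℂ)⁻¹ - 1)) •
    sandwich (σ₀ + σ₃) (σ₀ - σ₃) (part01 (offDiagPart (liftForm Ft θ z)))

/-- `Ω(a, θ) = Ω̃(θ) + β₁'(a) + β₁''(a)`. -/
def deformedForm (Ft : ℂ → Circle → Mat) (a : ℝ) (θ : Circle) : MForm :=
  liftForm Ft θ + beta10 Ft a θ + beta01 Ft a θ

/-! ### Surfaces in hyperbolic space -/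

/-- The points of `D` at which `f` fails to be an immersion. -/
def singularSet (D : Set ℂ) (f : ℂ → R31) : Set ℂ :=
  {z | z ∈ D ∧ ¬ Function.Injective (fderiv ℝ f z)}

/-- The metric induced by `f` at `z` is a positive multiple of the flat metric of `ℂ`. -/
def IsConformalImmersionAt (f : ℂ → R31) (z : ℂ) : Prop :=
  Function.Injective (fderiv ℝ f z) ∧ ∃ ρ : ℝ, 0 < ρ ∧ ∀ v w : ℂ,
    lorentz (fderiv ℝ f z v) (fderiv ℝ f z w) = ρ * inner ℝ v w

/-- `n` is the unit normal in `T H³` of `f` at `z` for which `(f, f_x, f_y, n)` is a positively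
oriented basis of `ℝ^{3,1}`. -/
structure IsOrientedUnitNormal (f : ℂ → R31) (z : ℂ) (n : R31) : Prop where
  orth_pos : lorentz (f z) n = 0
  orth_x : lorentz (fderiv ℝ f z 1) n = 0
  orth_y : lorentz (fderiv ℝ f z Complex.I) n = 0
  unit : lorentz n n = 1
  oriented : 0 < (Matrix.of ![f z, fderiv ℝ f z 1, fderiv ℝ f z Complex.I, n]).det

/-- The mean curvature `(l G - 2 m F + n E) / (2 (E G - F²))` computed from the first fundamental
form `I = ⟨df, df⟩ = E dx² + 2F dx dy + G dy²` and the second fundamental form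
`II = -⟨df, dN⟩ = l dx² + 2m dx dy + n dy²`. -/
def meanCurvature (f N : ℂ → R31) (z : ℂ) : ℝ :=
  let fx := fderiv ℝ f z 1
  let fy := fderiv ℝ f z Complex.I
  let Nx := fderiv ℝ N z 1
  let Ny := fderiv ℝ N z Complex.I
  let E := lorentz fx fx
  let F := lorentz fx fy
  let G := lorentz fy fy
  let l := -lorentz fx Nx
  let m := -(lorentz fx Ny + lorentz fy Nx) / 2
  let n := -lorentz fy Ny
  (l * G - 2 * m * F + n * E) / (2 * (E * G - F ^ 2))

/-- `f : D → H³` is smooth, its singular points are isolated (they do not accumulate in `D`), and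
away from them `f` is a conformal immersion of constant mean curvature `H` with respect to its
positively oriented unit normal field. -/
structure IsConformalCMC (D : Set ℂ) (f : ℂ → R31) (H : ℝ) : Prop where
  mem_H3 : ∀ z ∈ D, f z ∈ H3
  smooth : ContDiffOn ℝ ∞ f D
  isolated : ∀ z ∈ D, ∀ᶠ w in nhdsWithin z {z}ᶜ, w ∉ singularSet D f
  conformal : ∀ z ∈ D \ singularSet D f, IsConformalImmersionAt f z
  cmc : ∃ N : ℂ → R31, ContDiffOn ℝ ∞ N (D \ singularSet D f) ∧
    ∀ z ∈ D \ singularSet D f, IsOrientedUnitNormal f z (N z) ∧ meanCurvature f N z = H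

/-- The map `f = F F*` into the Hermitian matrices, read in `ℝ^{3,1}`. -/
def immersionOf (F : ℂ → Mat) : ℂ → R31 := fun z => ofHerm (F z * (F z)ᴴ)

theorem toHerm_immersionOf (F : ℂ → Mat) (z : ℂ) : toHerm (immersionOf F z) = F z * (F z)ᴴ :=
  toHerm_ofHerm (Matrix.isHermitian_mul_conjTranspose_self (F z))

end HypCMC

end

open HypCMC

/-! Write the off-diagonal part of the lift form at θ = 1 as p dz + r dz̄ (upper right) and q dz + s
dz̄ (lower left). The deformation multiplies q by a and r by a⁻¹, besides the factors θ⁻¹ on dz and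
θ on dz̄.

Flatness. The diagonal of the curvature involves only the products ps and rq, in which all factors θ
and a cancel. Off the diagonal, flatness for every θ forces the dz- and dz̄-parts to be covariantly
closed separately (`IsExtendedLift.covD_eq_zero`), so rescaling one of them does no harm.

Geometry. The lift is unitary, so its form is skew-Hermitian: r = -q̄, s = -p̄. In Ω + Ω* the
diagonal and the dz̄-terms of the lower left entry cancel, and df = F(Ω + Ω*)F* is, in the moving
frame F, the off-diagonal Hermitian matrix with lower left entry (a - a⁻¹)θ⁻¹q dz. Since SL(2, ℂ)
acts by isometries preserving the volume form, f is conformal wherever q ≠ 0, with normal -Fσ₃F*.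
The dz-part of the normal's differential carries the factor -(a + a⁻¹) instead, and its dz̄-part is
trace-free, so H = (a + a⁻¹)/(a - a⁻¹).

Singularities. They are the zeros of q, hence zeros of pq. The two closedness equations make pq
holomorphic, and ⟨N_z, N_z⟩ = -4pq, so for non-conformal N the identity theorem isolates these
zeros. -/

open HypCMC

noncomputable section

namespace HypCMC

open ComplexConjugate

/-! ### Calculus of matrix-valued functions -/

/-- Entrywise real differentiability of a matrix-valued function at a point. -/
def DiffMatAt (F : ℂ → Mat) (z : ℂ) : Prop :=
  ∀ i j, DifferentiableAt ℝ (fun w => F w i j) z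

theorem dMat_apply (F : ℂ → Mat) (z v : ℂ) (i j : Fin 2) :
    dMat F z v i j = fderiv ℝ (fun w => F w i j) z v := rfl

theorem DiffMatAt.mul {F G : ℂ → Mat} {z : ℂ} (hF : DiffMatAt F z) (hG : DiffMatAt G z) :
    DiffMatAt (fun w => F w * G w) z := by
  intro i j
  simp only [Matrix.mul_apply, Fin.sum_univ_two]
  exact ((hF _ _).mul (hG _ _)).add ((hF _ _).mul (hG _ _))

theorem dMat_mul {F G : ℂ → Mat} {z : ℂ} (hF : DiffMatAt F z) (hG : DiffMatAt G z) (v : ℂ) :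
    dMat (fun w => F w * G w) z v = dMat F z v * G z + F z * dMat G z v := by
  ext i j
  simp only [dMat_apply, Matrix.mul_apply, Fin.sum_univ_two, Matrix.add_apply]
  have h k := ((hF i k).hasFDerivAt.fun_mul (hG k j).hasFDerivAt)
  rw [((h 0).fun_add (h 1)).fderiv]
  simp
  ring

theorem DiffMatAt.const (A : Mat) (z : ℂ) : DiffMatAt (fun _ => A) z :=
  fun _ _ => differentiableAt_const _

theorem dMat_const (A : Mat) (z v : ℂ) : dMat (fun _ => A) z v = 0 := by
  ext i j
  simp [dMat_apply]

theorem DiffMatAt.conjTranspose {F : ℂ → Mat} {z : ℂ} (hF : DiffMatAt F z) :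
    DiffMatAt (fun w => (F w)ᴴ) z :=
  fun i j => (hF j i).star

theorem dMat_conjTranspose (F : ℂ → Mat) (z v : ℂ) :
    dMat (fun w => (F w)ᴴ) z v = (dMat F z v)ᴴ := by
  ext i j
  simp only [dMat_apply, Matrix.conjTranspose_apply]
  rw [fderiv_star]
  simp

theorem dMat_congr {F G : ℂ → Mat} {D : Set ℂ} (hD : IsOpen D) (h : ∀ z ∈ D, F z = G z) {z : ℂ}
    (hz : z ∈ D) (v : ℂ) : dMat F z v = dMat G z v := by
  ext i j
  simp only [dMat_apply]
  rw [Filter.EventuallyEq.fderiv_eq]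
  filter_upwards [hD.mem_nhds hz] with w hw
  rw [h w hw]

theorem SmoothMatOn.diffMatAt {D : Set ℂ} (hD : IsOpen D) {F : ℂ → Mat} (hF : SmoothMatOn D F)
    {z : ℂ} (hz : z ∈ D) : DiffMatAt F z :=
  fun i j => ((hF i j).contDiffAt (hD.mem_nhds hz)).differentiableAt (by simp)

theorem SmoothMatOn.mul {D : Set ℂ} {F G : ℂ → Mat} (hF : SmoothMatOn D F)
    (hG : SmoothMatOn D G) : SmoothMatOn D (fun z => F z * G z) := by
  intro i j
  simp only [Matrix.mul_apply, Fin.sum_univ_two]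
  exact ((hF _ _).mul (hG _ _)).add ((hF _ _).mul (hG _ _))

theorem SmoothMatOn.const (D : Set ℂ) (A : Mat) : SmoothMatOn D (fun _ => A) :=
  fun _ _ => contDiffOn_const

theorem SmoothMatOn.conjTranspose {D : Set ℂ} {F : ℂ → Mat} (hF : SmoothMatOn D F) :
    SmoothMatOn D (fun z => (F z)ᴴ) := fun i j =>
  (starL' ℝ : ℂ ≃L[ℝ] ℂ).contDiff.comp_contDiffOn (hF j i)

theorem contDiffOn_fderiv_apply {D : Set ℂ} (hD : IsOpen D) {g : ℂ → ℂ}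
    (hg : ContDiffOn ℝ ∞ g D) (v : ℂ) : ContDiffOn ℝ ∞ (fun z => fderiv ℝ g z v) D :=
  (hg.fderiv_of_isOpen hD (m := ∞) (by simp)).clm_apply contDiffOn_const

theorem SmoothMatOn.dMat {D : Set ℂ} (hD : IsOpen D) {F : ℂ → Mat} (hF : SmoothMatOn D F)
    (v : ℂ) : SmoothMatOn D (fun z => dMat F z v) :=
  fun i j => contDiffOn_fderiv_apply hD (hF i j) v

theorem fderiv_fderiv_apply_comm {D : Set ℂ} (hD : IsOpen D) {g : ℂ → ℂ}
    (hg : ContDiffOn ℝ ∞ g D) {z : ℂ} (hz : z ∈ D) (v w : ℂ) :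
    fderiv ℝ (fun y => fderiv ℝ g y w) z v = fderiv ℝ (fun y => fderiv ℝ g y v) z w := by
  have hga := hg.contDiffAt (hD.mem_nhds hz)
  have hd : DifferentiableAt ℝ (fderiv ℝ g) z :=
    (hga.fderiv_right (m := ∞) (by simp)).differentiableAt (by simp)
  have hsymm : IsSymmSndFDerivAt ℝ g z := hga.isSymmSndFDerivAt (by simpa using ENat.LEInfty.out)
  rw [fderiv_clm_apply hd (differentiableAt_const _),
    fderiv_clm_apply hd (differentiableAt_const _)]
  simpa using hsymm v w

theorem dMat_dMat_comm {D : Set ℂ} (hD : IsOpen D) {F : ℂ → Mat} (hF : SmoothMatOn D F) {z : ℂ}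
    (hz : z ∈ D) (v w : ℂ) :
    HypCMC.dMat (fun y => HypCMC.dMat F y w) z v = HypCMC.dMat (fun y => HypCMC.dMat F y v) z w := by
  ext i j
  exact fderiv_fderiv_apply_comm hD (hF i j) hz v w

theorem mcForm_apply (F : ℂ → Mat) (z v : ℂ) : mcForm F z v = (F z)⁻¹ * dMat F z v := rfl

theorem mul_mcForm {F : ℂ → Mat} {z : ℂ} (h : (F z).det = 1) (v : ℂ) :
    F z * mcForm F z v = dMat F z v := by
  rw [mcForm_apply, ← Matrix.mul_assoc, Matrix.mul_nonsing_inv _ (by simp [h]), Matrix.one_mul]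

/-- On SL(2, ℂ) inversion is linear in the entries, which makes smoothness of `F⁻¹` immediate. -/
theorem inv_eq_of_det {A : Mat} (h : A.det = 1) : A⁻¹ = !![A 1 1, -A 0 1; -A 1 0, A 0 0] := by
  rw [Matrix.inv_def, h, Matrix.adjugate_fin_two]
  simp

theorem SmoothMatOn.inv {D : Set ℂ} {F : ℂ → Mat} (hF : SmoothMatOn D F)
    (hdet : ∀ z ∈ D, (F z).det = 1) : SmoothMatOn D (fun z => (F z)⁻¹) := by
  intro i j
  refine ContDiffOn.congr (f := fun z => (!![F z 1 1, -F z 0 1; -F z 1 0, F z 0 0] : Mat) i j) ?_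
    fun z hz => congrFun (congrFun (inv_eq_of_det (hdet z hz)) i) j
  fin_cases i <;> fin_cases j
  · exact hF 1 1
  · exact (hF 0 1).neg
  · exact (hF 1 0).neg
  · exact hF 0 0

theorem smooth_mcForm {D : Set ℂ} (hD : IsOpen D) {F : ℂ → Mat} (hF : SmoothMatOn D F)
    (hdet : ∀ z ∈ D, (F z).det = 1) (v : ℂ) : SmoothMatOn D (fun z => mcForm F z v) :=
  (hF.inv hdet).mul (hF.dMat hD v)

theorem wedgeBracket_self (Ω : MForm) (z v w : ℂ) :
    (1 / 2 : ℂ) • wedgeBracket Ω Ω z v w = Ω z v * Ω z w - Ω z w * Ω z v := by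
  simp only [wedgeBracket, Ring.lie_def]
  module

/-- The Maurer-Cartan form of a smooth `SL(2, ℂ)`-valued map is flat. -/
theorem flat_mcForm {D : Set ℂ} (hD : IsOpen D) {F : ℂ → Mat} (hF : SmoothMatOn D F)
    (hdet : ∀ z ∈ D, (F z).det = 1) {z : ℂ} (hz : z ∈ D) (v w : ℂ) :
    extD (mcForm F) z v w + (mcForm F z v * mcForm F z w - mcForm F z w * mcForm F z v) = 0 := by
  -- With Ω = F⁻¹dF, the second derivative is ∂_v ∂_w F = F(Ω(v)Ω(w) + ∂_v Ω(w)); its symmetry in v,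
  -- w is the flatness of Ω.
  have key (v w : ℂ) : dMat (fun y => dMat F y w) z v =
      F z * (mcForm F z v * mcForm F z w + dMat (fun y => mcForm F y w) z v) := by
    rw [← dMat_congr hD (fun y hy => mul_mcForm (hdet y hy) w) hz v,
      dMat_mul (hF.diffMatAt hD hz) ((smooth_mcForm hD hF hdet w).diffMatAt hD hz),
      ← mul_mcForm (hdet z hz) v, mul_add, mul_assoc]
  have h := dMat_dMat_comm hD hF hz v w
  rw [key, key] at h
  have h' := congrArg (fun M => (F z)⁻¹ * M) h
  simp only [← Matrix.mul_assoc, Matrix.nonsing_inv_mul (F z) (by simp [hdet z hz])] at h'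
  simp only [Matrix.one_mul] at h'
  rw [extD, ← sub_eq_zero.mpr h']
  abel

/-- The Maurer-Cartan form of a smooth `SU(2)`-valued map is skew-Hermitian. -/
theorem mcForm_skew {D : Set ℂ} (hD : IsOpen D) {F : ℂ → Mat} (hF : SmoothMatOn D F)
    (hU : ∀ z ∈ D, F z ∈ Matrix.specialUnitaryGroup (Fin 2) ℂ) {z : ℂ} (hz : z ∈ D) (v : ℂ) :
    (mcForm F z v)ᴴ = -mcForm F z v := by
  have hmul (y) (hy : y ∈ D) : (F y)ᴴ * F y = 1 :=
    Matrix.mem_unitaryGroup_iff'.mp (Matrix.mem_specialUnitaryGroup_iff.mp (hU y hy)).1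
  have hinv : (F z)⁻¹ = (F z)ᴴ := Matrix.inv_eq_left_inv (hmul z hz)
  -- Differentiate F*F = 1.
  have h := dMat_congr hD (G := fun _ => 1) hmul hz v
  have hFz := hF.diffMatAt hD hz
  rw [dMat_const, dMat_mul hFz.conjTranspose hFz, dMat_conjTranspose] at h
  rw [mcForm_apply, hinv, Matrix.conjTranspose_mul, Matrix.conjTranspose_conjTranspose]
  exact eq_neg_of_add_eq_zero_left h

/-! ### Coefficients of the lift form and of its deformation -/

/-- The coefficient of `dz` in the `(i, j)` entry of a 1-form at a point. -/
def coeff10 (η : ℂ →ₗ[ℝ] Mat) (i j : Fin 2) : ℂ := (1 / 2) * (η 1 i j - Complex.I * η Complex.I i j)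

/-- The coefficient of `dz̄` in the `(i, j)` entry of a 1-form at a point. -/
def coeff01 (η : ℂ →ₗ[ℝ] Mat) (i j : Fin 2) : ℂ := (1 / 2) * (η 1 i j + Complex.I * η Complex.I i j)

theorem form_apply (η : ℂ →ₗ[ℝ] Mat) (v : ℂ) (i j : Fin 2) :
    η v i j = v.re * η 1 i j + v.im * η Complex.I i j := by
  have h : v = v.re • (1 : ℂ) + v.im • Complex.I := by
    apply Complex.ext <;> simp
  conv_lhs => rw [h, map_add, map_smul, map_smul]
  simp

theorem part10_apply (η : ℂ →ₗ[ℝ] Mat) (v : ℂ) (i j : Fin 2) :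
    part10 η v i j = v * coeff10 η i j := by
  have h1 := form_apply η v i j
  have h2 := form_apply η (Complex.I * v) i j
  have hv : v = v.re + v.im * Complex.I := (Complex.re_add_im v).symm
  simp [part10, coeff10, h1, h2]
  linear_combination (-(1 / 2) * (η 1 i j - Complex.I * η Complex.I i j)) * hv +
    (1 / 2 : ℂ) * v.im * η Complex.I i j * Complex.I_sq

theorem part01_apply (η : ℂ →ₗ[ℝ] Mat) (v : ℂ) (i j : Fin 2) :
    part01 η v i j = conj v * coeff01 η i j := by
  have h1 := form_apply η v i j
  have h2 := form_apply η (Complex.I * v) i j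
  have hv : conj v = v.re - v.im * Complex.I := by apply Complex.ext <;> simp
  simp [part01, coeff01, h1, h2]
  linear_combination (-(1 / 2) * (η 1 i j + Complex.I * η Complex.I i j)) * hv +
    (1 / 2 : ℂ) * v.im * η Complex.I i j * Complex.I_sq

theorem sandwich_σ₃ (η : ℂ →ₗ[ℝ] Mat) (v : ℂ) :
    sandwich σ₃ σ₃ η v = !![η v 0 0, -η v 0 1; -η v 1 0, η v 1 1] := by
  rw [sandwich, LinearMap.comp_apply, LinearMap.comp_apply, LinearMap.mulLeft_apply,
    LinearMap.mulRight_apply, Matrix.eta_fin_two (η v)]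
  ext i j
  fin_cases i <;> fin_cases j <;> simp [σ₃]

theorem offDiagPart_apply (η : ℂ →ₗ[ℝ] Mat) (v : ℂ) :
    offDiagPart η v = !![0, η v 0 1; η v 1 0, 0] := by
  rw [offDiagPart, LinearMap.smul_apply, LinearMap.sub_apply, sandwich_σ₃]
  ext i j
  fin_cases i <;> fin_cases j <;> simp <;> ring

theorem diagPart_apply (η : ℂ →ₗ[ℝ] Mat) (v : ℂ) :
    diagPart η v = !![η v 0 0, 0; 0, η v 1 1] := by
  rw [diagPart, LinearMap.smul_apply, LinearMap.add_apply, sandwich_σ₃]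
  ext i j
  fin_cases i <;> fin_cases j <;> simp <;> ring

theorem part10_offDiagPart (η : ℂ →ₗ[ℝ] Mat) (v : ℂ) :
    part10 (offDiagPart η) v = !![0, v * coeff10 η 0 1; v * coeff10 η 1 0, 0] := by
  ext i j
  rw [part10_apply]
  fin_cases i <;> fin_cases j <;> simp [coeff10, offDiagPart_apply]

theorem part01_offDiagPart (η : ℂ →ₗ[ℝ] Mat) (v : ℂ) :
    part01 (offDiagPart η) v = !![0, conj v * coeff01 η 0 1; conj v * coeff01 η 1 0, 0] := by
  ext i j
  rw [part01_apply]
  fin_cases i <;> fin_cases j <;> simp [coeff01, offDiagPart_apply]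

/-- The value at `v` of the deformation with parameters `t`, `a` of a 1-form at a point. -/
def deformedMat (η : ℂ →ₗ[ℝ] Mat) (t a v : ℂ) : Mat :=
  !![η v 0 0, t⁻¹ * (v * coeff10 η 0 1) + a⁻¹ * (t * (conj v * coeff01 η 0 1));
    a * (t⁻¹ * (v * coeff10 η 1 0)) + t * (conj v * coeff01 η 1 0), η v 1 1]

section Lift

variable {D : Set ℂ} {N : ℂ → EuclideanSpace ℝ (Fin 3)} {Ft : ℂ → Circle → Mat}

/-- The undeformed loop is the case a = 1, so a single curvature computation serves both Ω̃(θ) and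
Ω(a, θ). -/
theorem IsExtendedLift.liftForm_apply (hFt : IsExtendedLift D N Ft) (θ : Circle) {z : ℂ}
    (hz : z ∈ D) (v : ℂ) :
    liftForm Ft θ z v = deformedMat (liftForm Ft 1 z) θ 1 v := by
  rw [liftForm, hFt.mcForm_eq θ z hz, LinearMap.add_apply, LinearMap.add_apply,
    LinearMap.smul_apply, LinearMap.smul_apply, part10_offDiagPart, part01_offDiagPart,
    diagPart_apply]
  ext i j
  fin_cases i <;> fin_cases j <;> simp [deformedMat, liftForm]

theorem IsExtendedLift.coeff10_liftForm (hFt : IsExtendedLift D N Ft) (θ : Circle) {z : ℂ}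
    (hz : z ∈ D) :
    coeff10 (liftForm Ft θ z) 0 1 = (θ : ℂ)⁻¹ * coeff10 (liftForm Ft 1 z) 0 1 ∧
    coeff10 (liftForm Ft θ z) 1 0 = (θ : ℂ)⁻¹ * coeff10 (liftForm Ft 1 z) 1 0 := by
  constructor <;> rw [coeff10, hFt.liftForm_apply θ hz, hFt.liftForm_apply θ hz] <;>
    simp [deformedMat] <;> ring_nf <;> simp <;> ring

theorem IsExtendedLift.coeff01_liftForm (hFt : IsExtendedLift D N Ft) (θ : Circle) {z : ℂ}
    (hz : z ∈ D) :
    coeff01 (liftForm Ft θ z) 0 1 = (θ : ℂ) * coeff01 (liftForm Ft 1 z) 0 1 ∧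
    coeff01 (liftForm Ft θ z) 1 0 = (θ : ℂ) * coeff01 (liftForm Ft 1 z) 1 0 := by
  constructor <;> rw [coeff01, hFt.liftForm_apply θ hz, hFt.liftForm_apply θ hz] <;>
    simp [deformedMat] <;> ring_nf <;> simp <;> ring

theorem IsExtendedLift.deformedForm_apply (hFt : IsExtendedLift D N Ft) (a : ℝ) (θ : Circle)
    {z : ℂ} (hz : z ∈ D) (v : ℂ) :
    deformedForm Ft a θ z v = deformedMat (liftForm Ft 1 z) θ a v := by
  simp only [deformedForm, Pi.add_apply, LinearMap.add_apply, beta10, beta01, LinearMap.smul_apply,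
    sandwich, LinearMap.comp_apply, LinearMap.mulLeft_apply, LinearMap.mulRight_apply,
    part10_offDiagPart, part01_offDiagPart, hFt.liftForm_apply θ hz, hFt.coeff10_liftForm θ hz,
    hFt.coeff01_liftForm θ hz]
  ext i j
  fin_cases i <;> fin_cases j <;>
    simp [deformedMat, σ₀, σ₃] <;> ring

theorem IsExtendedLift.det_eq_one (hFt : IsExtendedLift D N Ft) (θ : Circle) {z : ℂ}
    (hz : z ∈ D) : (Ft z θ).det = 1 :=
  (Matrix.mem_specialUnitaryGroup_iff.mp ((hFt.mem_loop z hz).1 θ)).2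

theorem IsExtendedLift.smooth_liftForm (hFt : IsExtendedLift D N Ft) (hD : IsOpen D) (θ : Circle)
    (v : ℂ) : SmoothMatOn D (fun z => liftForm Ft θ z v) :=
  smooth_mcForm hD (hFt.smooth θ) (fun _ hz => hFt.det_eq_one θ hz) v

end Lift

/-! ### Flatness of the deformed form -/

/-- The 2-form `dΩ + ½ [Ω ∧ Ω]` evaluated on a pair of vectors. -/
def curvature (Ω : MForm) (z v w : ℂ) : Mat :=
  extD Ω z v w + (Ω z v * Ω z w - Ω z w * Ω z v)

/-- The covariant exterior derivative of the `(1,0)`-part of an off-diagonal entry. -/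
def covD10 (X : MForm) (i j : Fin 2) (z v w : ℂ) : ℂ :=
  w * fderiv ℝ (fun y => coeff10 (X y) i j) z v - v * fderiv ℝ (fun y => coeff10 (X y) i j) z w +
    coeff10 (X z) i j * (w * (X z v i i - X z v j j) - v * (X z w i i - X z w j j))

/-- The covariant exterior derivative of the `(0,1)`-part of an off-diagonal entry. -/
def covD01 (X : MForm) (i j : Fin 2) (z v w : ℂ) : ℂ :=
  conj w * fderiv ℝ (fun y => coeff01 (X y) i j) z v -
    conj v * fderiv ℝ (fun y => coeff01 (X y) i j) z w +
    coeff01 (X z) i j * (conj w * (X z v i i - X z v j j) - conj v * (X z w i i - X z w j j))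

theorem contDiffOn_coeff10 {D : Set ℂ} {X : MForm} (hX : ∀ v, SmoothMatOn D (fun z => X z v))
    (i j : Fin 2) : ContDiffOn ℝ ∞ (fun z => coeff10 (X z) i j) D :=
  contDiffOn_const.mul ((hX _ i j).sub (contDiffOn_const.mul (hX _ i j)))

theorem contDiffOn_coeff01 {D : Set ℂ} {X : MForm} (hX : ∀ v, SmoothMatOn D (fun z => X z v))
    (i j : Fin 2) : ContDiffOn ℝ ∞ (fun z => coeff01 (X z) i j) D :=
  contDiffOn_const.mul ((hX _ i j).add (contDiffOn_const.mul (hX _ i j)))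

theorem smooth_deformedMat {D : Set ℂ} {X : MForm} (hX : ∀ v, SmoothMatOn D (fun z => X z v))
    (t a v : ℂ) : SmoothMatOn D (fun z => deformedMat (X z) t a v) := by
  have h10 := contDiffOn_coeff10 hX
  have h01 := contDiffOn_coeff01 hX
  intro i j
  fin_cases i <;> fin_cases j
  · exact hX v 0 0
  · exact (contDiffOn_const.mul (contDiffOn_const.mul (h10 0 1))).add
      (contDiffOn_const.mul (contDiffOn_const.mul (contDiffOn_const.mul (h01 0 1))))
  · exact (contDiffOn_const.mul (contDiffOn_const.mul (contDiffOn_const.mul (h10 1 0)))).add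
      (contDiffOn_const.mul (contDiffOn_const.mul (h01 1 0)))
  · exact hX v 1 1

theorem fderiv_const_mul_add {g h : ℂ → ℂ} {z : ℂ} (hg : DifferentiableAt ℝ g z)
    (hh : DifferentiableAt ℝ h z) (c d v : ℂ) :
    fderiv ℝ (fun y => c * g y + d * h y) z v = c * fderiv ℝ g z v + d * fderiv ℝ h z v := by
  rw [((hg.hasFDerivAt.const_mul c).fun_add (hh.hasFDerivAt.const_mul d)).fderiv]
  simp

/-- The parameters cancel on the diagonal, where a dz-coefficient always meets the dz̄-coefficient
of the opposite entry; off the diagonal the diagonal part of the form acts as a connection on each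
piece separately. -/
theorem curvature_deformedMat {D : Set ℂ} (hD : IsOpen D) {X Ω : MForm}
    (hX : ∀ v, SmoothMatOn D (fun z => X z v)) {t a : ℂ} (ht : t ≠ 0) (ha : a ≠ 0)
    (hΩ : ∀ z ∈ D, ∀ v, Ω z v = deformedMat (X z) t a v) {z : ℂ} (hz : z ∈ D) (v w : ℂ) :
    curvature Ω z v w =
      !![extD X z v w 0 0 + (v * conj w - w * conj v) *
          (coeff10 (X z) 0 1 * coeff01 (X z) 1 0 - coeff01 (X z) 0 1 * coeff10 (X z) 1 0),
        t⁻¹ * covD10 X 0 1 z v w + a⁻¹ * t * covD01 X 0 1 z v w;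
        a * t⁻¹ * covD10 X 1 0 z v w + t * covD01 X 1 0 z v w,
        extD X z v w 1 1 + (v * conj w - w * conj v) *
          (coeff10 (X z) 1 0 * coeff01 (X z) 0 1 - coeff01 (X z) 1 0 * coeff10 (X z) 0 1)] := by
  have h10 i j := ((contDiffOn_coeff10 hX i j).contDiffAt (hD.mem_nhds hz)).differentiableAt
    (by simp)
  have h01 i j := ((contDiffOn_coeff01 hX i j).contDiffAt (hD.mem_nhds hz)).differentiableAt
    (by simp)
  have hd (v w : ℂ) : dMat (fun y => Ω y w) z v =
      !![dMat (fun y => X y w) z v 0 0, t⁻¹ * w * fderiv ℝ (fun y => coeff10 (X y) 0 1) z v +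
          a⁻¹ * t * conj w * fderiv ℝ (fun y => coeff01 (X y) 0 1) z v;
        a * t⁻¹ * w * fderiv ℝ (fun y => coeff10 (X y) 1 0) z v +
          t * conj w * fderiv ℝ (fun y => coeff01 (X y) 1 0) z v,
        dMat (fun y => X y w) z v 1 1] := by
    rw [dMat_congr hD (fun y hy => hΩ y hy w) hz v, ← fderiv_const_mul_add (h10 _ _) (h01 _ _),
      ← fderiv_const_mul_add (h10 _ _) (h01 _ _)]
    ext i j
    fin_cases i <;> fin_cases j <;> simp [dMat_apply, deformedMat, mul_assoc]
  rw [curvature, extD, hd, hd, hΩ z hz, hΩ z hz]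
  ext i j
  fin_cases i <;> fin_cases j <;>
    simp [deformedMat, extD, covD10, covD01] <;>
    field_simp <;> ring

section Lift

variable {D : Set ℂ} {N : ℂ → EuclideanSpace ℝ (Fin 3)} {Ft : ℂ → Circle → Mat}

theorem IsExtendedLift.curvature_liftForm (hFt : IsExtendedLift D N Ft) (hD : IsOpen D)
    (θ : Circle) {z : ℂ} (hz : z ∈ D) (v w : ℂ) : curvature (liftForm Ft θ) z v w = 0 :=
  flat_mcForm hD (hFt.smooth θ) (fun _ hz => hFt.det_eq_one θ hz) hz v w

/-- The circle action separates the off-diagonal part of the Maurer-Cartan equation into its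
`(1,0)`- and `(0,1)`-components. -/
theorem IsExtendedLift.covD_eq_zero (hFt : IsExtendedLift D N Ft) (hD : IsOpen D) {z : ℂ}
    (hz : z ∈ D) (v w : ℂ) :
    (covD10 (liftForm Ft 1) 0 1 z v w = 0 ∧ covD01 (liftForm Ft 1) 0 1 z v w = 0) ∧
    (covD10 (liftForm Ft 1) 1 0 z v w = 0 ∧ covD01 (liftForm Ft 1) 1 0 z v w = 0) := by
  have key (θ : Circle) := (hFt.curvature_liftForm hD θ hz v w).symm.trans
    (curvature_deformedMat hD (hFt.smooth_liftForm hD 1) θ.coe_ne_zero one_ne_zero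
      (fun z hz v => hFt.liftForm_apply θ hz v) hz v w)
  -- The two values θ = 1 and θ = i already separate θ⁻¹ from θ.
  have sep (x y : ℂ) (h : ∀ θ : Circle, (θ : ℂ)⁻¹ * x + θ * y = 0) : x = 0 ∧ y = 0 := by
    have h1 := h 1
    have h2 := h ⟨Complex.I, by simp [Submonoid.unitSphere]⟩
    simp at h1 h2
    have h3 : Complex.I * (y - x) = 0 := by linear_combination h2
    have h4 := (mul_eq_zero.mp h3).resolve_left Complex.I_ne_zero
    exact ⟨by linear_combination (h1 - h4) / 2, by linear_combination (h1 + h4) / 2⟩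
  refine ⟨sep _ _ fun θ => ?_, sep _ _ fun θ => ?_⟩
  · simpa using (congrFun (congrFun (key θ) 0) 1).symm
  · simpa using (congrFun (congrFun (key θ) 1) 0).symm

theorem IsExtendedLift.smooth_deformedForm (hFt : IsExtendedLift D N Ft) (hD : IsOpen D) (a : ℝ)
    (θ : Circle) (v : ℂ) : SmoothMatOn D (fun z => deformedForm Ft a θ z v) := fun i j =>
  (smooth_deformedMat (hFt.smooth_liftForm hD 1) θ a v i j).congr
    fun _ hz => congrFun (congrFun (hFt.deformedForm_apply a θ hz v) i) j

theorem IsExtendedLift.satisfiesMaurerCartan (hFt : IsExtendedLift D N Ft) (hD : IsOpen D)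
    {a : ℝ} (ha : a ≠ 0) (θ : Circle) : SatisfiesMaurerCartan D (deformedForm Ft a θ) := by
  refine ⟨hFt.smooth_deformedForm hD a θ, fun z hz v w => ?_⟩
  rw [wedgeBracket_self]
  change curvature _ z v w = 0
  have h1 := (hFt.curvature_liftForm hD 1 hz v w).symm.trans
    (curvature_deformedMat hD (hFt.smooth_liftForm hD 1) (Circle.coe_ne_zero 1) one_ne_zero
      (fun z hz v => hFt.liftForm_apply 1 hz v) hz v w)
  rw [curvature_deformedMat hD (hFt.smooth_liftForm hD 1) θ.coe_ne_zero (by exact_mod_cast ha)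
      (fun z hz v => hFt.deformedForm_apply a θ hz v) hz v w]
  obtain ⟨⟨hp, hr⟩, hq, hs⟩ := hFt.covD_eq_zero hD hz v w
  rw [hp, hr, hq, hs] at h1 ⊢
  simpa using h1.symm

end Lift

/-! ### The Hopf differential of the harmonic map -/

/-- The Hopf differential of `N`, up to a constant factor, read off from the lift. -/
def hopfCoeff (Ft : ℂ → Circle → Mat) (z : ℂ) : ℂ :=
  coeff10 (liftForm Ft 1 z) 0 1 * coeff10 (liftForm Ft 1 z) 1 0

/-- The Hermitian matrix of a vector of `ℝ³`. -/
def sigmaVec (x : EuclideanSpace ℝ (Fin 3)) : Mat :=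
  (x 0 : ℂ) • σ₁ + (x 1 : ℂ) • σ₂ + (x 2 : ℂ) • σ₃

theorem sigmaVec_eq (x : EuclideanSpace ℝ (Fin 3)) :
    sigmaVec x = !![(x 2 : ℂ), x 0 + Complex.I * x 1; x 0 - Complex.I * x 1, -x 2] := by
  ext i j
  fin_cases i <;> fin_cases j <;> simp [sigmaVec, σ₁, σ₂, σ₃] <;> ring

/-- The entries of `sigmaVec` as continuous linear maps. -/
def sigmaEntry (i j : Fin 2) : EuclideanSpace ℝ (Fin 3) →L[ℝ] ℂ :=
  LinearMap.toContinuousLinearMap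
    { toFun := fun x => sigmaVec x i j
      map_add' := fun x y => by simp [sigmaVec]; ring
      map_smul' := fun c x => by simp [sigmaVec]; ring }

theorem sigmaEntry_apply (i j : Fin 2) (x : EuclideanSpace ℝ (Fin 3)) :
    sigmaEntry i j x = sigmaVec x i j := rfl

theorem dMat_sigmaVec {N : ℂ → EuclideanSpace ℝ (Fin 3)} {z : ℂ} (hN : DifferentiableAt ℝ N z)
    (v : ℂ) : dMat (fun y => sigmaVec (N y)) z v = sigmaVec (fderiv ℝ N z v) := by
  ext i j
  have h := ((sigmaEntry i j).hasFDerivAt.comp z hN.hasFDerivAt).fderiv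
  rw [dMat_apply, ← sigmaEntry_apply]
  exact congrArg (fun L => L v) h

/-- Expresses the inner product in a form visibly invariant under unitary conjugation, so that the
frame drops out. -/
theorem trace_sigmaVec_mul (x y : EuclideanSpace ℝ (Fin 3)) :
    (sigmaVec x * sigmaVec y).trace = 2 * (inner ℝ x y : ℝ) := by
  rw [sigmaVec_eq, sigmaVec_eq, PiLp.inner_apply, Fin.sum_univ_three]
  simp [Matrix.trace_fin_two]
  linear_combination (-2 * (x 1 : ℂ) * y 1) * Complex.I_sq

/-- The left side is what the product rule leaves of d(F S F*) when dF = F X; skewness of X turns it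
into a commutator. -/
theorem gauge_skew (F S : Mat) {X : Mat} (hX : Xᴴ = -X) :
    (F * X * S + F * 0) * Fᴴ + F * S * (F * X)ᴴ = F * (X * S - S * X) * Fᴴ := by
  rw [Matrix.conjTranspose_mul, hX]
  noncomm_ring

section Lift

variable {D : Set ℂ} {N : ℂ → EuclideanSpace ℝ (Fin 3)} {Ft : ℂ → Circle → Mat}

theorem IsExtendedLift.differentiableOn_hopfCoeff (hFt : IsExtendedLift D N Ft) (hD : IsOpen D) :
    DifferentiableOn ℂ (hopfCoeff Ft) D := by
  intro z hz
  refine DifferentiableAt.differentiableWithinAt ?_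
  have h10 i j := ((contDiffOn_coeff10 (hFt.smooth_liftForm hD 1) i j).contDiffAt
    (hD.mem_nhds hz)).differentiableAt (by simp)
  -- On the pair (1, i) these are Cauchy-Riemann equations for the two coefficients with connection
  -- terms of opposite sign, which cancel in the product.
  obtain ⟨⟨hp, -⟩, hq, -⟩ := hFt.covD_eq_zero hD hz 1 Complex.I
  rw [differentiableAt_complex_iff_differentiableAt_real]
  refine ⟨(h10 0 1).mul (h10 1 0), ?_⟩
  have h := ((h10 0 1).hasFDerivAt.fun_mul (h10 1 0).hasFDerivAt).fderiv
  change fderiv ℝ (hopfCoeff Ft) z = _ at h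
  rw [h]
  simp only [covD10] at hp hq
  simp
  linear_combination -coeff10 (liftForm Ft 1 z) 1 0 * hp - coeff10 (liftForm Ft 1 z) 0 1 * hq

theorem IsExtendedLift.liftForm_skew (hFt : IsExtendedLift D N Ft) (hD : IsOpen D) (θ : Circle)
    {z : ℂ} (hz : z ∈ D) (v : ℂ) : (liftForm Ft θ z v)ᴴ = -liftForm Ft θ z v :=
  mcForm_skew hD (hFt.smooth θ) (fun z hz => (hFt.mem_loop z hz).1 θ) hz v

theorem IsExtendedLift.conj_liftForm (hFt : IsExtendedLift D N Ft) (hD : IsOpen D) (θ : Circle)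
    {z : ℂ} (hz : z ∈ D) (v : ℂ) (i j : Fin 2) :
    conj (liftForm Ft θ z v i j) = -liftForm Ft θ z v j i :=
  congrFun (congrFun (hFt.liftForm_skew hD θ hz v) j) i

theorem IsExtendedLift.conj_coeff01 (hFt : IsExtendedLift D N Ft) (hD : IsOpen D) (θ : Circle)
    {z : ℂ} (hz : z ∈ D) (i j : Fin 2) :
    conj (coeff01 (liftForm Ft θ z) i j) = -coeff10 (liftForm Ft θ z) j i := by
  simp [coeff01, coeff10, hFt.conj_liftForm hD θ hz, map_ofNat]
  ring

theorem IsExtendedLift.coeff01_eq (hFt : IsExtendedLift D N Ft) (hD : IsOpen D) (θ : Circle)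
    {z : ℂ} (hz : z ∈ D) (i j : Fin 2) :
    coeff01 (liftForm Ft θ z) i j = -conj (coeff10 (liftForm Ft θ z) j i) := by
  rw [← Complex.conj_conj (coeff01 (liftForm Ft θ z) i j), hFt.conj_coeff01 hD θ hz, map_neg]

theorem IsExtendedLift.mul_liftForm (hFt : IsExtendedLift D N Ft) (θ : Circle) {z : ℂ}
    (hz : z ∈ D) (v : ℂ) : Ft z θ * liftForm Ft θ z v = dMat (fun w => Ft w θ) z v :=
  mul_mcForm (F := fun w => Ft w θ) (hFt.det_eq_one θ hz) v

/-- From N = Fσ₃F* one gets dN = F[Ω, σ₃]F*; the bracket kills the diagonal of Ω, and the trace form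
does not see F. -/
theorem IsExtendedLift.inner_fderiv (hFt : IsExtendedLift D N Ft) (hD : IsOpen D)
    (hN : ContDiffOn ℝ ∞ N D) {z : ℂ} (hz : z ∈ D) (v w : ℂ) :
    ((inner ℝ (fderiv ℝ N z v) (fderiv ℝ N z w) : ℝ) : ℂ) =
      -2 * (liftForm Ft 1 z v 0 1 * liftForm Ft 1 z w 1 0 +
        liftForm Ft 1 z v 1 0 * liftForm Ft 1 z w 0 1) := by
  have hU (y) (hy : y ∈ D) : (Ft y 1)ᴴ * Ft y 1 = 1 := Matrix.mem_unitaryGroup_iff'.mp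
    (Matrix.mem_specialUnitaryGroup_iff.mp ((hFt.mem_loop y hy).1 1)).1
  have hd := (hFt.smooth 1).diffMatAt hD hz
  have key (v : ℂ) : sigmaVec (fderiv ℝ N z v) =
      Ft z 1 * (liftForm Ft 1 z v * σ₃ - σ₃ * liftForm Ft 1 z v) * (Ft z 1)ᴴ := by
    rw [← dMat_sigmaVec ((hN.contDiffAt (hD.mem_nhds hz)).differentiableAt (by simp)),
      dMat_congr hD (G := fun y => Ft y 1 * σ₃ * (Ft y 1)ᴴ) (fun y hy => by
        rw [← Matrix.inv_eq_left_inv (hU y hy), hFt.projects y hy, sigmaVec]) hz,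
      dMat_mul (hd.mul (.const _ _)) hd.conjTranspose, dMat_mul hd (.const _ _),
      dMat_conjTranspose, dMat_const, ← hFt.mul_liftForm 1 hz v]
    exact gauge_skew _ σ₃ (hFt.liftForm_skew hD 1 hz v)
  have h := trace_sigmaVec_mul (fderiv ℝ N z v) (fderiv ℝ N z w)
  rw [key, key] at h
  have hcomm (A B : Mat) : (Ft z 1 * A * (Ft z 1)ᴴ * (Ft z 1 * B * (Ft z 1)ᴴ)).trace =
      (A * B).trace := by
    rw [show Ft z 1 * A * (Ft z 1)ᴴ * (Ft z 1 * B * (Ft z 1)ᴴ) =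
      Ft z 1 * (A * ((Ft z 1)ᴴ * Ft z 1) * B * (Ft z 1)ᴴ) by noncomm_ring, hU z hz,
      Matrix.trace_mul_comm, Matrix.mul_one, Matrix.mul_assoc, hU z hz, Matrix.mul_one]
  have hbr (M : Mat) : M * σ₃ - σ₃ * M = !![0, -2 * M 0 1; 2 * M 1 0, 0] := by
    rw [Matrix.eta_fin_two M]
    ext i j
    fin_cases i <;> fin_cases j <;> simp [σ₃] <;> ring
  rw [hcomm, hbr, hbr] at h
  simp [Matrix.trace_fin_two] at h
  linear_combination -h / 2

theorem IsExtendedLift.isConformalMapOn (hFt : IsExtendedLift D N Ft) (hD : IsOpen D)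
    (hN : ContDiffOn ℝ ∞ N D) (h0 : ∀ z ∈ D, hopfCoeff Ft z = 0) : IsConformalMapOn D N := by
  intro z hz
  have hi := hFt.inner_fderiv hD hN hz
  have hp := h0 z hz
  -- Skewness makes this product the conjugate of the Hopf coefficient.
  have hr : coeff01 (liftForm Ft 1 z) 0 1 * coeff01 (liftForm Ft 1 z) 1 0 = 0 := by
    rw [hFt.coeff01_eq hD 1 hz, hFt.coeff01_eq hD 1 hz, neg_mul_neg, ← map_mul, mul_comm]
    exact (congrArg conj hp).trans (map_zero _)
  have hX (v i j) : liftForm Ft 1 z v i j =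
      v * coeff10 (liftForm Ft 1 z) i j + conj v * coeff01 (liftForm Ft 1 z) i j := by
    rw [← part10_apply, ← part01_apply]
    simp [part10, part01]
    ring
  simp only [hX] at hi
  rw [hopfCoeff] at hp
  constructor
  · have h1 := hi 1 1
    have h2 := hi Complex.I Complex.I
    simp only [map_one, Complex.conj_I] at h1 h2
    have h3 : (inner ℝ (fderiv ℝ N z 1) (fderiv ℝ N z 1) : ℝ) =
        inner ℝ (fderiv ℝ N z Complex.I) (fderiv ℝ N z Complex.I) := by
      rw [← Complex.ofReal_inj]
      generalize coeff10 (liftForm Ft 1 z) 0 1 = p at *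
      generalize coeff10 (liftForm Ft 1 z) 1 0 = q at *
      generalize coeff01 (liftForm Ft 1 z) 0 1 = r at *
      generalize coeff01 (liftForm Ft 1 z) 1 0 = s at *
      linear_combination h1 - h2 - 8 * hp - 8 * hr +
        (4 * p * q + 4 * r * s - 4 * p * s - 4 * r * q) * Complex.I_sq
    rw [real_inner_self_eq_norm_sq, real_inner_self_eq_norm_sq] at h3
    exact (sq_eq_sq₀ (norm_nonneg _) (norm_nonneg _)).mp h3
  · have h1 := hi 1 Complex.I
    simp only [map_one, Complex.conj_I] at h1
    rw [← Complex.ofReal_inj, h1, Complex.ofReal_zero]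
    linear_combination -4 * Complex.I * hp + 4 * Complex.I * hr

/-- For a non-conformal harmonic map the Hopf differential has isolated zeros. -/
theorem IsExtendedLift.eventually_hopfCoeff_ne_zero (hFt : IsExtendedLift D N Ft) (hD : IsOpen D)
    (hc : IsPreconnected D) (hN : ContDiffOn ℝ ∞ N D) (hnc : ¬ IsConformalMapOn D N)
    {z : ℂ} (hz : z ∈ D) : ∀ᶠ w in nhdsWithin z {z}ᶜ, hopfCoeff Ft w ≠ 0 := by
  have han : AnalyticOnNhd ℂ (hopfCoeff Ft) D :=
    (hFt.differentiableOn_hopfCoeff hD).analyticOnNhd hD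
  rcases (han z hz).eventually_eq_zero_or_eventually_ne_zero with h | h
  · exact absurd (hFt.isConformalMapOn hD hN
      (han.eqOn_zero_of_preconnected_of_eventuallyEq_zero hc hz h)) hnc
  · exact h

end Lift

/-! ### Regularity of solutions -/

/-- Solutions of `F⁻¹ dF = Ω` with `Ω` smooth are smooth. -/
theorem IsSLSolution.smooth {D : Set ℂ} (hD : IsOpen D) {Ω : MForm} {F : ℂ → Mat}
    (hF : IsSLSolution D Ω F) (hΩ : ∀ v, SmoothMatOn D (fun z => Ω z v)) : SmoothMatOn D F := by
  -- Bootstrap: dF = FΩ is of class Cⁿ as soon as F is.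
  have main (n : ℕ) : ∀ i j, ContDiffOn ℝ n (fun z => F z i j) D := by
    induction n with
    | zero =>
      exact fun i j => contDiffOn_zero.mpr fun z hz =>
        (hF.differentiableAt z hz i j).continuousAt.continuousWithinAt
    | succ n ih =>
      intro i j
      rw [Nat.cast_succ, contDiffOn_succ_iff_fderiv_of_isOpen hD]
      refine ⟨fun z hz => (hF.differentiableAt z hz i j).differentiableWithinAt, by simp, ?_⟩
      rw [contDiffOn_clm_apply]
      intro v
      refine ContDiffOn.congr (f := fun z => (F z * Ω z v) i j) ?_ fun z hz => ?_
      · simp only [Matrix.mul_apply, Fin.sum_univ_two]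
        have h k l := (hΩ v k l).of_le (m := (n : WithTop ℕ∞)) (by exact_mod_cast le_top)
        exact ((ih _ _).mul (h _ _)).add ((ih _ _).mul (h _ _))
      · rw [← hF.mcForm_eq z hz, mul_mcForm (hF.det_eq_one z hz), dMat_apply]
  exact fun i j => contDiffOn_infty.mpr fun n => main n i j

/-! ### Hermitian matrices and the Lorentz product -/

/-- `ofHerm` as a continuous linear map. -/
def ofHermL : (Fin 2 → Fin 2 → ℂ) →L[ℝ] R31 :=
  LinearMap.toContinuousLinearMap
    { toFun := fun X => ofHerm X
      map_add' := fun X Y => by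
        ext i
        fin_cases i <;> simp [ofHerm] <;> ring
      map_smul' := fun c X => by
        ext i
        fin_cases i <;> simp [ofHerm] <;> ring }

theorem fderiv_ofHerm {Y : ℂ → Mat} {z : ℂ} (hY : DiffMatAt Y z) (v : ℂ) :
    fderiv ℝ (fun y => ofHerm (Y y)) z v = ofHerm (dMat Y z v) := by
  have hrow (i) : HasFDerivAt (fun y => Y y i)
      (ContinuousLinearMap.pi fun j => fderiv ℝ (fun y => Y y i j) z) z :=
    hasFDerivAt_pi.mpr fun j => (hY i j).hasFDerivAt
  have h : HasFDerivAt (fun y => (Y y : Fin 2 → Fin 2 → ℂ))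
      (ContinuousLinearMap.pi fun i => ContinuousLinearMap.pi fun j =>
        fderiv ℝ (fun y => Y y i j) z) z := hasFDerivAt_pi.mpr hrow
  exact congrArg (fun L => L v) (ofHermL.hasFDerivAt.comp z h).fderiv

theorem SmoothMatOn.ofHerm {D : Set ℂ} {Y : ℂ → Mat} (hY : SmoothMatOn D Y) :
    ContDiffOn ℝ ∞ (fun z => HypCMC.ofHerm (Y z)) D :=
  ofHermL.contDiff.comp_contDiffOn
    (contDiffOn_pi.mpr fun i => contDiffOn_pi.mpr fun j => hY i j)

theorem lorentz_ofHerm {X Y : Mat} (hX : X.IsHermitian) (hY : Y.IsHermitian) :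
    (lorentz (ofHerm X) (ofHerm Y) : ℂ) =
      -(1 / 2) * (X 0 0 * Y 1 1 + X 1 1 * Y 0 0 - X 0 1 * Y 1 0 - X 1 0 * Y 0 1) := by
  have key (x y : R31) : (lorentz x y : ℂ) =
      -(1 / 2) * (toHerm x 0 0 * toHerm y 1 1 + toHerm x 1 1 * toHerm y 0 0 -
        toHerm x 0 1 * toHerm y 1 0 - toHerm x 1 0 * toHerm y 0 1) := by
    rw [toHerm_eq, toHerm_eq]
    simp [lorentz]
    linear_combination (x 2 * y 2 : ℂ) * Complex.I_sq
  rw [key, toHerm_ofHerm hX, toHerm_ofHerm hY]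

/-- `SL(2, ℂ)` acts on Minkowski space by isometries. -/
theorem lorentz_conj {F : Mat} (hF : F.det = 1) {X Y : Mat} (hX : X.IsHermitian)
    (hY : Y.IsHermitian) : lorentz (ofHerm (F * X * Fᴴ)) (ofHerm (F * Y * Fᴴ)) =
      lorentz (ofHerm X) (ofHerm Y) := by
  have h1 := hF
  have h2 : (Fᴴ).det = 1 := by rw [Matrix.det_conjTranspose, hF, star_one]
  rw [← Complex.ofReal_inj, lorentz_ofHerm (Matrix.isHermitian_mul_mul_conjTranspose F hX)
    (Matrix.isHermitian_mul_mul_conjTranspose F hY), lorentz_ofHerm hX hY]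
  generalize Fᴴ = G at *
  rw [Matrix.det_fin_two] at h1 h2
  -- The product is -1 times the polarized determinant, so only det F = det F* = 1 matters and F*
  -- may be any matrix G.
  simp only [Matrix.mul_apply, Fin.sum_univ_two]
  linear_combination (-(1 / 2) * (X 0 0 * Y 1 1 + X 1 1 * Y 0 0 - X 0 1 * Y 1 0 - X 1 0 * Y 0 1)) *
    ((G 0 0 * G 1 1 - G 0 1 * G 1 0) * h1 + h2)

/-! ### The volume form of Minkowski space in matrix entries -/

/-- The entries of a matrix as a row vector. -/
def entryVec (X : Mat) : Fin 4 → ℂ := ![X 0 0, X 0 1, X 1 0, X 1 1]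

/-- The matrix expressing Hermitian entries in terms of Minkowski coordinates. -/
def entryBasis : Matrix (Fin 4) (Fin 4) ℂ :=
  !![1, 0, 0, 1; 0, 1, 1, 0; 0, Complex.I, -Complex.I, 0; 1, 0, 0, -1]

theorem det_entryBasis : entryBasis.det ≠ 0 := by
  have h : entryBasis.det = 4 * Complex.I := by
    simp [entryBasis, Matrix.det_succ_row_zero, Fin.sum_univ_succ, Fin.succAbove]
    ring
  rw [h]
  simp

theorem det_entryVec_ofHerm {X : Fin 4 → Mat} (hX : ∀ k, (X k).IsHermitian) :
    (Matrix.of fun k => entryVec (X k)).det =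
      ((Matrix.of fun k => ofHerm (X k)).det : ℂ) * entryBasis.det := by
  have h : (Matrix.of fun k => entryVec (X k)) =
      (Complex.ofRealHom.mapMatrix (Matrix.of fun k => ofHerm (X k))) * entryBasis := by
    ext k l
    conv_lhs => rw [Matrix.of_apply, ← toHerm_ofHerm (hX k), toHerm_eq]
    fin_cases l <;>
      simp [entryVec, entryBasis, Matrix.mul_apply, Fin.sum_univ_four] <;> ring
  rw [h, Matrix.det_mul, ← RingHom.map_det]
  rfl

/-- Left multiplication by F acts on each of the two columns of a matrix as F, hence the square of
the determinant. -/
theorem det_entryVec_mul_left (F : Mat) (X : Fin 4 → Mat) :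
    (Matrix.of fun k => entryVec (F * X k)).det =
      (Matrix.of fun k => entryVec (X k)).det * F.det ^ 2 := by
  have h : (Matrix.of fun k => entryVec (F * X k)) = (Matrix.of fun k => entryVec (X k)) *
      !![F 0 0, 0, F 1 0, 0; 0, F 0 0, 0, F 1 0; F 0 1, 0, F 1 1, 0; 0, F 0 1, 0, F 1 1] := by
    ext k l
    fin_cases l <;> simp [entryVec, Matrix.mul_apply, Fin.sum_univ_two, Fin.sum_univ_four] <;> ring
  rw [h, Matrix.det_mul, Matrix.det_fin_two]
  congr 1
  simp [Matrix.det_succ_row_zero, Fin.sum_univ_succ, Fin.succAbove]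
  ring

theorem det_entryVec_mul_right (G : Mat) (X : Fin 4 → Mat) :
    (Matrix.of fun k => entryVec (X k * G)).det =
      (Matrix.of fun k => entryVec (X k)).det * G.det ^ 2 := by
  have h : (Matrix.of fun k => entryVec (X k * G)) = (Matrix.of fun k => entryVec (X k)) *
      !![G 0 0, G 0 1, 0, 0; G 1 0, G 1 1, 0, 0; 0, 0, G 0 0, G 0 1; 0, 0, G 1 0, G 1 1] := by
    ext k l
    fin_cases l <;> simp [entryVec, Matrix.mul_apply, Fin.sum_univ_two, Fin.sum_univ_four]
  rw [h, Matrix.det_mul, Matrix.det_fin_two]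
  congr 1
  simp [Matrix.det_succ_row_zero, Fin.sum_univ_succ, Fin.succAbove]
  ring

/-- `SL(2, ℂ)` acts on Minkowski space preserving the volume form. -/
theorem det_ofHerm_conj {F : Mat} (hF : F.det = 1) {X : Fin 4 → Mat}
    (hX : ∀ k, (X k).IsHermitian) :
    (Matrix.of fun k => ofHerm (F * X k * Fᴴ)).det = (Matrix.of fun k => ofHerm (X k)).det := by
  have h1 := det_entryVec_ofHerm fun k => Matrix.isHermitian_mul_mul_conjTranspose F (hX k)
  rw [det_entryVec_mul_right, det_entryVec_mul_left, det_entryVec_ofHerm hX,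
    Matrix.det_conjTranspose, hF, star_one, one_pow, mul_one, mul_one] at h1
  exact_mod_cast (mul_right_cancel₀ det_entryBasis h1).symm

/-- The off-diagonal Hermitian matrix with lower left entry `w`. -/
def offDiag (w : ℂ) : Mat := !![0, conj w; w, 0]

theorem offDiag_isHermitian (w : ℂ) : (offDiag w).IsHermitian := by
  ext i j
  fin_cases i <;> fin_cases j <;> simp [offDiag]

theorem offDiag_zero : offDiag 0 = 0 := by
  ext i j
  fin_cases i <;> fin_cases j <;> simp [offDiag]

theorem mul_neg_σ₃ (M : Mat) : M * -σ₃ = !![-M 0 0, M 0 1; -M 1 0, M 1 1] := by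
  ext i j
  fin_cases i <;> fin_cases j <;> simp [σ₃, Matrix.mul_apply, Fin.sum_univ_two]

theorem neg_σ₃_mul (M : Mat) : -σ₃ * M = !![-M 0 0, -M 0 1; M 1 0, M 1 1] := by
  ext i j
  fin_cases i <;> fin_cases j <;> simp [σ₃, Matrix.mul_apply, Fin.sum_univ_two]

theorem neg_σ₃_isHermitian : (-σ₃).IsHermitian := by
  ext i j
  fin_cases i <;> fin_cases j <;> simp [σ₃]

theorem ofHerm_one : ofHerm 1 = ![1, 0, 0, 0] := by
  ext i
  fin_cases i <;> simp [ofHerm]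

theorem ofHerm_neg_σ₃ : ofHerm (-σ₃) = ![0, 0, 0, -1] := by
  ext i
  fin_cases i <;> simp [ofHerm, σ₃]
  norm_num

theorem ofHerm_offDiag (w : ℂ) : ofHerm (offDiag w) = ![0, w.re, -w.im, 0] := by
  ext i
  fin_cases i <;> simp [ofHerm, offDiag]
  ring

theorem lorentz_offDiag (s t : ℂ) :
    lorentz (ofHerm (offDiag s)) (ofHerm (offDiag t)) = s.re * t.re + s.im * t.im := by
  simp [ofHerm_offDiag, lorentz]

/-- F F* is the image of the base point (1, 0, 0, 0) under an isometry, and its x⁰ is half the sum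
of the squared moduli of the entries of F. -/
theorem mem_H3_ofHerm {F : Mat} (hF : F.det = 1) : ofHerm (F * Fᴴ) ∈ H3 := by
  constructor
  · have h := lorentz_conj hF (X := 1) (Y := 1) Matrix.isHermitian_one Matrix.isHermitian_one
    rw [Matrix.mul_one] at h
    rw [h, ofHerm_one]
    simp [lorentz]
  · have h : ofHerm (F * Fᴴ) 0 = (Complex.normSq (F 0 0) + Complex.normSq (F 0 1) +
        Complex.normSq (F 1 0) + Complex.normSq (F 1 1)) / 2 := by
      simp [ofHerm, Matrix.mul_apply, Fin.sum_univ_two, Complex.normSq_apply]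
      ring
    rw [h]
    by_contra hneg
    have n00 := Complex.normSq_nonneg (F 0 0)
    have n01 := Complex.normSq_nonneg (F 0 1)
    have n10 := Complex.normSq_nonneg (F 1 0)
    have n11 := Complex.normSq_nonneg (F 1 1)
    have h00 : F 0 0 = 0 := Complex.normSq_eq_zero.mp (by linarith)
    have h01 : F 0 1 = 0 := Complex.normSq_eq_zero.mp (by linarith)
    rw [Matrix.det_fin_two, h00, h01] at hF
    simp at hF

/-! ### Immersions with off-diagonal differential in a moving frame -/

/-- The derivative of `F S F*` in the moving frame `F`. -/
theorem fderiv_ofHerm_conj {D : Set ℂ} {Ω : MForm} {F : ℂ → Mat} (hF : IsSLSolution D Ω F)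
    (S : Mat) {z : ℂ} (hz : z ∈ D) (v : ℂ) :
    fderiv ℝ (fun y => ofHerm (F y * S * (F y)ᴴ)) z v =
      ofHerm (F z * (Ω z v * S + S * (Ω z v)ᴴ) * (F z)ᴴ) := by
  have hd : DiffMatAt F z := hF.differentiableAt z hz
  rw [fderiv_ofHerm ((hd.mul (.const S z)).mul hd.conjTranspose),
    dMat_mul (hd.mul (.const S z)) hd.conjTranspose, dMat_mul hd (.const S z), dMat_const,
    dMat_conjTranspose, ← mul_mcForm (hF.det_eq_one z hz), hF.mcForm_eq z hz,
    Matrix.conjTranspose_mul]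
  congr 1
  noncomm_ring

theorem immersionOf_eq (F : ℂ → Mat) :
    immersionOf F = fun y => ofHerm (F y * 1 * (F y)ᴴ) := by
  funext y
  rw [immersionOf, Matrix.mul_one]

/-- The normal field `-F σ₃ F*`. -/
def normalOf (F : ℂ → Mat) : ℂ → R31 := fun z => ofHerm (F z * -σ₃ * (F z)ᴴ)

section Frame

variable {f n : ℂ → R31} {z : ℂ} {A : Mat} {k u : ℂ} {b c : ℝ}

/-- `offDiag` maps ℂ isometrically into the (x¹, x²)-plane, and v ↦ ckv is a similarity. -/
theorem isConformalImmersionAt_of_frame (hA : A.det = 1) (hc : c ≠ 0) (hk : k ≠ 0)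
    (hf : ∀ v, fderiv ℝ f z v = ofHerm (A * offDiag (c * k * v) * Aᴴ)) :
    IsConformalImmersionAt f z := by
  have hpos : 0 < c ^ 2 * Complex.normSq k :=
    mul_pos (by positivity) (Complex.normSq_pos.mpr hk)
  have hmet (v w : ℂ) : lorentz (fderiv ℝ f z v) (fderiv ℝ f z w) =
      c ^ 2 * Complex.normSq k * inner ℝ v w := by
    rw [hf, hf, lorentz_conj hA (offDiag_isHermitian _) (offDiag_isHermitian _), lorentz_offDiag,
      Complex.inner]
    simp [Complex.normSq_apply]
    ring
  refine ⟨(injective_iff_map_eq_zero _).mpr fun v hv => ?_, _, hpos, hmet⟩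
  have h := hmet v v
  rw [hv] at h
  have h0 : lorentz 0 0 = 0 := by simp [lorentz]
  rw [h0] at h
  exact inner_self_eq_zero.mp ((mul_eq_zero.mp h.symm).resolve_left hpos.ne')

/-- The sign of -σ₃ is forced: w ↦ (Re w, -Im w) reverses orientation, and the -1 in the x³-slot
makes the determinant c²|k|², whatever the sign of c. -/
theorem isOrientedUnitNormal_of_frame (hA : A.det = 1) (hc : c ≠ 0) (hk : k ≠ 0)
    (hfz : f z = ofHerm (A * 1 * Aᴴ))
    (hf : ∀ v, fderiv ℝ f z v = ofHerm (A * offDiag (c * k * v) * Aᴴ)) :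
    IsOrientedUnitNormal f z (ofHerm (A * -σ₃ * Aᴴ)) := by
  constructor
  · rw [hfz, lorentz_conj hA Matrix.isHermitian_one neg_σ₃_isHermitian, ofHerm_one, ofHerm_neg_σ₃]
    simp [lorentz]
  · rw [hf, lorentz_conj hA (offDiag_isHermitian _) neg_σ₃_isHermitian, ofHerm_offDiag,
      ofHerm_neg_σ₃]
    simp [lorentz]
  · rw [hf, lorentz_conj hA (offDiag_isHermitian _) neg_σ₃_isHermitian, ofHerm_offDiag,
      ofHerm_neg_σ₃]
    simp [lorentz]
  · rw [lorentz_conj hA neg_σ₃_isHermitian neg_σ₃_isHermitian, ofHerm_neg_σ₃]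
    simp [lorentz]
  · have h := det_ofHerm_conj hA
      (X := ![1, offDiag (c * k * 1), offDiag (c * k * Complex.I), -σ₃]) fun i => by
        fin_cases i
        exacts [Matrix.isHermitian_one, offDiag_isHermitian _, offDiag_isHermitian _,
          neg_σ₃_isHermitian]
    have e1 : Matrix.of ![f z, fderiv ℝ f z 1, fderiv ℝ f z Complex.I, ofHerm (A * -σ₃ * Aᴴ)] =
        Matrix.of fun i => ofHerm
          (A * ![1, offDiag (c * k * 1), offDiag (c * k * Complex.I), -σ₃] i * Aᴴ) := by
      rw [hfz, hf, hf]
      ext i j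
      fin_cases i <;> rfl
    have e2 : (Matrix.of fun i => ofHerm
        ((![1, offDiag (c * k * 1), offDiag (c * k * Complex.I), -σ₃] : Fin 4 → Mat) i)) =
        !![1, 0, 0, 0; 0, c * k.re, -(c * k.im), 0; 0, -(c * k.im), -(c * k.re), 0;
          0, 0, 0, -1] := by
      ext i j
      fin_cases i
      · exact congrFun ofHerm_one j
      · refine (congrFun (ofHerm_offDiag _) j).trans ?_
        fin_cases j <;> simp
      · refine (congrFun (ofHerm_offDiag _) j).trans ?_
        fin_cases j <;> simp
      · exact congrFun ofHerm_neg_σ₃ j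
    rw [e1, h, e2]
    have hdet : (!![1, 0, 0, 0; 0, c * k.re, -(c * k.im), 0; 0, -(c * k.im), -(c * k.re), 0;
        0, 0, 0, -1] : Matrix (Fin 4) (Fin 4) ℝ).det = c ^ 2 * Complex.normSq k := by
      simp [Matrix.det_succ_row_zero, Fin.sum_univ_succ, Fin.succAbove, Complex.normSq_apply]
      ring
    rw [hdet]
    exact mul_pos (by positivity) (Complex.normSq_pos.mpr hk)

/-- The conjugate-linear term 2u v̄ contributes opposite amounts to l and n and drops out of the
trace. -/
theorem meanCurvature_of_frame (hA : A.det = 1) (hc : c ≠ 0) (hk : k ≠ 0)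
    (hf : ∀ v, fderiv ℝ f z v = ofHerm (A * offDiag (c * k * v) * Aᴴ))
    (hn : ∀ v, fderiv ℝ n z v = ofHerm (A * offDiag (-(b * k * v + 2 * u * conj v)) * Aᴴ)) :
    meanCurvature f n z = b / c := by
  have hkk : k.re ^ 2 + k.im ^ 2 ≠ 0 := by
    have := (Complex.normSq_pos.mpr hk).ne'
    rw [Complex.normSq_apply] at this
    rwa [sq, sq]
  simp only [meanCurvature, hf, hn,
    lorentz_conj hA (offDiag_isHermitian _) (offDiag_isHermitian _), lorentz_offDiag]
  simp
  rw [div_eq_div_iff _ hc]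
  · ring
  -- This is EG - F² for the metric c²|k|²|dz|².
  · have : c ^ 4 * (k.re ^ 2 + k.im ^ 2) ^ 2 ≠ 0 := by positivity
    intro h
    apply this
    linear_combination h / 2

end Frame

/-! ### The surface `F F*` of a deformed frame -/

section Lift

variable {D : Set ℂ} {N : ℂ → EuclideanSpace ℝ (Fin 3)} {Ft : ℂ → Circle → Mat} {F : ℂ → Mat}

theorem IsExtendedLift.deformedForm_add_conjTranspose (hFt : IsExtendedLift D N Ft)
    (hD : IsOpen D) (a : ℝ) (θ : Circle) {z : ℂ} (hz : z ∈ D) (v : ℂ) :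
    deformedForm Ft a θ z v * 1 + 1 * (deformedForm Ft a θ z v)ᴴ =
      offDiag ((a - a⁻¹ : ℝ) * ((θ : ℂ)⁻¹ * coeff10 (liftForm Ft 1 z) 1 0) * v) := by
  have hθ : conj (θ : ℂ) = (θ : ℂ)⁻¹ := by rw [← Circle.coe_inv_eq_conj, Circle.coe_inv]
  rw [hFt.deformedForm_apply a θ hz]
  ext i j
  fin_cases i <;> fin_cases j <;>
    simp [deformedMat, offDiag, hθ, hFt.conj_liftForm hD 1 hz, hFt.coeff01_eq hD 1 hz] <;> ring

/-- The sign change from -σ₃ makes both the dz- and the dz̄-terms add up, while the diagonal still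
cancels by skewness. -/
theorem IsExtendedLift.deformedForm_mul_neg_σ₃ (hFt : IsExtendedLift D N Ft)
    (hD : IsOpen D) (a : ℝ) (θ : Circle) {z : ℂ} (hz : z ∈ D) (v : ℂ) :
    deformedForm Ft a θ z v * -σ₃ + -σ₃ * (deformedForm Ft a θ z v)ᴴ =
      offDiag (-((a + a⁻¹ : ℝ) * ((θ : ℂ)⁻¹ * coeff10 (liftForm Ft 1 z) 1 0) * v +
        2 * (θ * coeff01 (liftForm Ft 1 z) 1 0) * conj v)) := by
  have hθ : conj (θ : ℂ) = (θ : ℂ)⁻¹ := by rw [← Circle.coe_inv_eq_conj, Circle.coe_inv]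
  rw [hFt.deformedForm_apply a θ hz, mul_neg_σ₃, neg_σ₃_mul]
  ext i j
  fin_cases i <;> fin_cases j <;>
    simp [deformedMat, offDiag, hθ, map_ofNat, hFt.conj_liftForm hD 1 hz, hFt.coeff01_eq hD 1 hz] <;>
    ring

theorem IsExtendedLift.isConformalCMC (hFt : IsExtendedLift D N Ft) (hD : IsOpen D)
    (hc : IsPreconnected D) (hN : ContDiffOn ℝ ∞ N D) (hnc : ¬ IsConformalMapOn D N)
    {a : ℝ} (ha : 0 < a) (ha1 : a ≠ 1) {θ : Circle} (hF : IsSLSolution D (deformedForm Ft a θ) F) :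
    IsConformalCMC D (immersionOf F) ((a ^ 2 + 1) / (a ^ 2 - 1)) := by
  have ha2 : a ^ 2 - 1 ≠ 0 := by
    rw [show a ^ 2 - 1 = (a - 1) * (a + 1) by ring]
    exact mul_ne_zero (sub_ne_zero.mpr ha1) (by positivity)
  have hca : a - a⁻¹ ≠ 0 := by
    rw [show a - a⁻¹ = (a ^ 2 - 1) / a by field_simp]
    exact div_ne_zero ha2 ha.ne'
  have hsm := hF.smooth hD (hFt.smooth_deformedForm hD a θ)
  let k : ℂ → ℂ := fun z => (θ : ℂ)⁻¹ * coeff10 (liftForm Ft 1 z) 1 0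
  have hdf {z} (hz : z ∈ D) (v : ℂ) : fderiv ℝ (immersionOf F) z v =
      ofHerm (F z * offDiag ((a - a⁻¹ : ℝ) * k z * v) * (F z)ᴴ) := by
    rw [immersionOf_eq, fderiv_ofHerm_conj hF 1 hz, hFt.deformedForm_add_conjTranspose hD a θ hz]
  have hdn {z} (hz : z ∈ D) (v : ℂ) : fderiv ℝ (normalOf F) z v =
      ofHerm (F z * offDiag (-((a + a⁻¹ : ℝ) * k z * v +
        2 * (θ * coeff01 (liftForm Ft 1 z) 1 0) * conj v)) * (F z)ᴴ) := by
    unfold normalOf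
    rw [fderiv_ofHerm_conj hF (-σ₃) hz, hFt.deformedForm_mul_neg_σ₃ hD a θ hz]
  have himm {z} (hz : z ∈ D) (hk : k z ≠ 0) : IsConformalImmersionAt (immersionOf F) z :=
    isConformalImmersionAt_of_frame (hF.det_eq_one z hz) hca hk (hdf hz)
  -- If k vanishes then df = 0, so together with `himm` the singular set is exactly the zero set of
  -- k.
  have hne {z} (hz : z ∈ D \ singularSet D (immersionOf F)) : k z ≠ 0 := by
    intro hk
    refine hz.2 ⟨hz.1, fun hinj => one_ne_zero (α := ℂ) (hinj ?_)⟩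
    rw [map_zero, hdf hz.1, hk, mul_zero, zero_mul, offDiag_zero, Matrix.mul_zero, Matrix.zero_mul]
    exact map_zero ofHermL
  refine ⟨fun z hz => mem_H3_ofHerm (hF.det_eq_one z hz), (hsm.mul hsm.conjTranspose).ofHerm,
    fun z hz => ?_, fun z hz => himm hz.1 (hne hz), normalOf F, ?_, fun z hz => ⟨?_, ?_⟩⟩
  · filter_upwards [hFt.eventually_hopfCoeff_ne_zero hD hc hN hnc hz] with w hw hsing
    refine hsing.2 (himm hsing.1 ?_).1
    exact mul_ne_zero (inv_ne_zero θ.coe_ne_zero) (right_ne_zero_of_mul hw)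
  · exact ((hsm.mul (.const D (-σ₃))).mul hsm.conjTranspose).ofHerm.mono Set.sdiff_subset
  · exact isOrientedUnitNormal_of_frame (hF.det_eq_one z hz.1) hca (hne hz)
      (congrFun (immersionOf_eq F) z) (hdf hz.1)
  · rw [meanCurvature_of_frame (hF.det_eq_one z hz.1) hca (hne hz) (hdf hz.1) (hdn hz.1)]
    rw [div_eq_div_iff hca ha2]
    field_simp

end Lift

end HypCMC

end

theorem theorem4 (D : Set ℂ) (hDo : IsOpen D) (hDs : IsSimplyConnected D)
    (N : ℂ → EuclideanSpace ℝ (Fin 3)) (hN : IsHarmonicSphereMap D N)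
    (hnc : ¬ IsConformalMapOn D N)
    (Ft : ℂ → Circle → Mat) (hFt : IsExtendedLift D N Ft)
    (a : ℝ) (ha : 0 < a) (θ : Circle) :
    SatisfiesMaurerCartan D (deformedForm Ft a θ) ∧
    (a ≠ 1 → ∀ F : ℂ → Mat, IsSLSolution D (deformedForm Ft a θ) F →
      IsConformalCMC D (immersionOf F) ((a ^ 2 + 1) / (a ^ 2 - 1))) :=
  ⟨hFt.satisfiesMaurerCartan hDo ha.ne' θ, fun ha1 _ hF =>
    hFt.isConformalCMC hDo hDs.isPathConnected.isConnected.isPreconnected hN.smooth hnc ha ha1 hF⟩
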